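/- For integers $m\ge 2$ and $n\ge 0$, let the $m$-ary partition polynomial $p_m(n,t)\in\mathbb{Z}[t]$ be defined by the power series expansion \[ \prod_{j=0}^{\infty}\frac{1}{1-tq^{m^{j}}}=\sum_{n=0}^{\infty}p_m(n,t)\,q^{n}, \] and let $a_m(k,n)$ be the coefficient of $t^k$ in $p_m(n,t)$; that is, $a_m(k,n)$ is the number of partitions of $n$ into exactly $k$ parts, each of which is a power $m^i$ $(i\ge 0)$ of $m$. For an integer $b\ge 2$, a sequence $\mathbf{s}=(s_n)_{n=0}^{\infty}$ is called $b$-automatic if its $b$-kernel \[ \mathcal{K}_b(\mathbf{s})=\big\{(s_{b^{i}n+j})_{n=0}^{\infty}\ :\ i\ge 0,\ 0\le j<b^{i}\big\} \] is finite. Let $p$ be a prime number. Then for every integer $k\ge 0$ the sequence $(a_p(k,n)\bmod p)_{n=0}^{\infty}$ is $p$-automatic. -/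

import Mathlib

open scoped Polynomial PowerSeries

noncomputable section

namespace MaryPartition

/-- The factor `1 / (1 - t * q ^ (m ^ j))` as a power series in `q` over `ℤ[t]`.
The polynomial variable of `ℤ[X]` is `t`, the power series variable is `q`. -/
def factor (m j : ℕ) : ℤ[X]⟦X⟧ :=
  PowerSeries.invOfUnit
    (1 - PowerSeries.C (Polynomial.X : ℤ[X]) * PowerSeries.X ^ (m ^ j)) 1

/-- For `m ≥ 1` the series `factor m j` is the inverse of `1 - t * q ^ (m ^ j)`. -/
theorem mul_factor {m : ℕ} (hm : 1 ≤ m) (j : ℕ) :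
    (1 - PowerSeries.C (Polynomial.X : ℤ[X]) * PowerSeries.X ^ (m ^ j)) * factor m j = 1 := by
  refine PowerSeries.mul_invOfUnit _ _ ?_
  have h : m ≠ 0 := by omega
  simp [h]

open scoped PowerSeries.WithPiTopology in
/-- The generating function `F_m(q, t) = ∏_{j ≥ 0} 1 / (1 - t * q ^ (m ^ j))`, an element of
`ℤ[t]⟦q⟧`. The product converges coefficientwise: `ℤ[t]` is discrete and `ℤ[t]⟦q⟧` has the
product topology. -/
def genFun (m : ℕ) : ℤ[X]⟦X⟧ :=
  letI : TopologicalSpace ℤ[X] := ⊥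
  ∏' j : ℕ, factor m j

open scoped PowerSeries.WithPiTopology in
/-- For `m ≥ 2` the infinite product that defines `genFun m` converges. -/
theorem hasProd_genFun {m : ℕ} (hm : 2 ≤ m) :
    letI : TopologicalSpace ℤ[X] := ⊥
    HasProd (fun j : ℕ => factor m j) (genFun m) := by
  let _ : TopologicalSpace ℤ[X] := ⊥
  refine Multipliable.hasProd ?_
  have h1 : (fun j : ℕ => factor m j) = fun j : ℕ => 1 +
      PowerSeries.X ^ (m ^ j) * (PowerSeries.C (Polynomial.X : ℤ[X]) * factor m j) := by
    funext j
    linear_combination mul_factor (by omega : 1 ≤ m) j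
  rw [h1]
  refine PowerSeries.WithPiTopology.multipliable_one_add_of_tendsto_order_atTop_nhds_top
    (R := ℤ[X]) ?_
  refine ENat.tendsto_nhds_top_iff_natCast_lt.mpr fun n => ?_
  filter_upwards [Filter.eventually_ge_atTop n] with j hj
  have h2 : n < m ^ j := lt_of_le_of_lt hj (Nat.lt_pow_self (by omega))
  have h3 : ((n : ℕ) : ℕ∞) < ((m ^ j : ℕ) : ℕ∞) := by exact_mod_cast h2
  refine lt_of_lt_of_le h3 (le_trans ?_ (PowerSeries.le_order_mul _ _))
  rw [PowerSeries.order_X_pow]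
  exact le_self_add

/-- The `m`-ary partition polynomial `p_m(n, t)`, the coefficient of `q ^ n` in `F_m(q, t)`. -/
def poly (m n : ℕ) : ℤ[X] :=
  PowerSeries.coeff n (genFun m)

/-- The number `a_m(k, n)`, the coefficient of `t ^ k` in `p_m(n, t)`. -/
def a (m k n : ℕ) : ℤ :=
  (poly m n).coeff k

end MaryPartition

namespace AutomaticSequence

/-- The `k`-kernel of a sequence `s`, the set of all sequences `(s (k ^ i * n + j))_n` with
`i ≥ 0` and `0 ≤ j < k ^ i`. -/
def kernel {α : Type*} (k : ℕ) (s : ℕ → α) : Set (ℕ → α) :=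
  {u | ∃ i j : ℕ, j < k ^ i ∧ u = fun n => s (k ^ i * n + j)}

/-- For `k ≥ 2`, a sequence is `k`-automatic if its `k`-kernel is finite. -/
def IsAutomatic {α : Type*} (k : ℕ) (s : ℕ → α) : Prop :=
  2 ≤ k ∧ (kernel k s).Finite

end AutomaticSequence

end

/-!
Let `G_k = ∑ₙ a_p(k, n) qⁿ`. Splitting off the factor `j = 0` of the infinite product gives
`(1 - t q) F(q, t) = F(q ^ p, t)` (`one_sub_mul_genFun`), and comparing coefficients of `t ^ k`
gives `G_{k+1}(q) = q G_k(q) + G_{k+1}(q ^ p)` and `G_0(q) = G_0(q ^ p)`.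

Let `Λ_r` denote the decimation `(uₙ) ↦ (u_{pn+r})`. A sequence with values in a finite ring is
`p`-automatic as soon as it lies in a finitely generated module of sequences that is stable under
all `Λ_r` with `r < p` (`LiesInStableModule.isAutomatic`): such a module is a finite set, and it
contains the whole `p`-kernel. This property passes from `G_k` to `G_{k+1}`: if `W` is a stable
module that contains `G_k`, then `W + q W` is stable and contains `q G_k`
(`LiesInStableModule.delay`). As `Λ_r` maps `G_{k+1}(q ^ p)` to `G_{k+1}` for `r = 0` and to `0`
for `0 < r < p`, adding `G_{k+1}` as one more generator again gives a stable module
(`LiesInStableModule.of_decimate`). The induction starts from the zero module for `G_0`.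
-/

open scoped Polynomial PowerSeries

namespace AutomaticSequence

variable {R : Type*} [CommRing R]

/-- The decimation `(uₙ) ↦ (u_{bn+r})`, as a linear map on sequences. -/
def decimate (b r : ℕ) : (ℕ → R) →ₗ[R] (ℕ → R) :=
  LinearMap.funLeft R R fun n => b * n + r

@[simp]
theorem decimate_apply (b r : ℕ) (u : ℕ → R) (n : ℕ) : decimate b r u n = u (b * n + r) := rfl

/-- The delay `(u₀, u₁, …) ↦ (0, u₀, u₁, …)`, which is multiplication of the generating function
by the variable. -/
def delay : (ℕ → R) →ₗ[R] (ℕ → R) where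
  toFun u n := if n = 0 then 0 else u (n - 1)
  map_add' u v := by ext n; by_cases h : n = 0 <;> simp [h]
  map_smul' c u := by ext n; by_cases h : n = 0 <;> simp [h]

@[simp]
theorem delay_zero (u : ℕ → R) : delay u 0 = 0 := rfl

@[simp]
theorem delay_succ (u : ℕ → R) (n : ℕ) : delay u (n + 1) = u n := rfl

theorem decimate_succ_delay (b r : ℕ) (u : ℕ → R) :
    decimate b (r + 1) (delay u) = decimate b r u := by
  ext n
  rw [decimate_apply, ← add_assoc, delay_succ, decimate_apply]

theorem decimate_zero_delay {b : ℕ} (hb : b ≠ 0) (u : ℕ → R) :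
    decimate b 0 (delay u) = delay (decimate b (b - 1) u) := by
  ext n
  cases n with
  | zero => simp
  | succ n =>
    have h : b * (n + 1) + 0 = (b * n + (b - 1)) + 1 := by
      rw [mul_add]
      omega
    rw [decimate_apply, h, delay_succ, delay_succ, decimate_apply]

/-- The sequence `s` lies in a finitely generated module of sequences that is stable under the
decimations `(uₙ) ↦ (u_{bn+r})` with `r < b`. -/
def LiesInStableModule (b : ℕ) (s : ℕ → R) : Prop :=
  ∃ W : Submodule R (ℕ → R), W.FG ∧ s ∈ W ∧ ∀ r < b, ∀ u ∈ W, decimate b r u ∈ W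

theorem LiesInStableModule.zero (b : ℕ) : LiesInStableModule b (0 : ℕ → R) :=
  ⟨⊥, Submodule.fg_bot, Submodule.zero_mem _, by simp⟩

theorem LiesInStableModule.delay {b : ℕ} (hb : b ≠ 0) {s : ℕ → R}
    (hs : LiesInStableModule b s) : LiesInStableModule b (delay s) := by
  obtain ⟨W, hfg, hsW, hW⟩ := hs
  refine ⟨W ⊔ W.map AutomaticSequence.delay, hfg.sup (hfg.map _),
    Submodule.mem_sup_right (Submodule.mem_map_of_mem hsW), fun r hr u hu => ?_⟩
  obtain ⟨v, hv, _, ⟨w, hw, rfl⟩, rfl⟩ := Submodule.mem_sup.mp hu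
  rw [map_add]
  refine add_mem (Submodule.mem_sup_left (hW r hr v hv)) ?_
  cases r with
  | zero =>
    rw [decimate_zero_delay hb]
    exact Submodule.mem_sup_right (Submodule.mem_map_of_mem (hW _ (by omega) w hw))
  | succ r =>
    rw [decimate_succ_delay]
    exact Submodule.mem_sup_left (hW r (by omega) w hw)

/-- In terms of generating functions, the hypotheses say that `G(q) = H(q) + G(q ^ b)`, where `G`
and `H` belong to `g` and `h`. -/
theorem LiesInStableModule.of_decimate {b : ℕ} {g h : ℕ → R} (hh : LiesInStableModule b h)
    (h₀ : decimate b 0 g = decimate b 0 h + g)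
    (h₁ : ∀ r < b, r ≠ 0 → decimate b r g = decimate b r h) : LiesInStableModule b g := by
  obtain ⟨W, hfg, hhW, hW⟩ := hh
  have hg : g ∈ W ⊔ Submodule.span R {g} :=
    Submodule.mem_sup_right (Submodule.mem_span_singleton_self g)
  refine ⟨W ⊔ Submodule.span R {g}, hfg.sup (Submodule.fg_span_singleton g), hg,
    fun r hr u hu => ?_⟩
  obtain ⟨v, hv, w, hw, rfl⟩ := Submodule.mem_sup.mp hu
  obtain ⟨c, rfl⟩ := Submodule.mem_span_singleton.mp hw
  rw [map_add, map_smul]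
  refine add_mem (Submodule.mem_sup_left (hW r hr v hv)) (Submodule.smul_mem _ c ?_)
  have hrh := Submodule.mem_sup_left (T := Submodule.span R {g}) (hW r hr h hhW)
  by_cases hr₀ : r = 0
  · subst hr₀
    rw [h₀]
    exact add_mem hrh hg
  · rwa [h₁ r hr hr₀]

/-- The form of `LiesInStableModule.of_decimate` that fits recurrences: the identity
`G(q) = H(q) + G(q ^ b)` needs to be checked away from the constant coefficient only. -/
theorem LiesInStableModule.of_succ {b : ℕ}
    (hb : 2 ≤ b) {g h : ℕ → R} (hh : LiesInStableModule b h) (h0 : h 0 = 0)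
    (hg : ∀ n, g (n + 1) = h (n + 1) + if b ∣ n + 1 then g ((n + 1) / b) else 0) :
    LiesInStableModule b g := by
  have hg' : ∀ n ≠ 0, g n = h n + if b ∣ n then g (n / b) else 0 := fun n hn => by
    obtain ⟨n, rfl⟩ := Nat.exists_eq_succ_of_ne_zero hn
    exact hg n
  refine hh.of_decimate ?_ fun r hr hr₀ => ?_
  · ext n
    rcases eq_or_ne n 0 with rfl | hn
    · simp [h0]
    · have hbn : b * n ≠ 0 := mul_ne_zero (by omega) hn
      simp [hg' _ hbn, Nat.mul_div_cancel_left n (show 0 < b by omega)]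
  · ext n
    have hd : ¬ b ∣ b * n + r := by
      rw [Nat.dvd_add_right (dvd_mul_right b n)]
      exact Nat.not_dvd_of_pos_of_lt (by omega) hr
    simp [hg' (b * n + r) (by omega), hd]

theorem kernel_subset_of_stable {b : ℕ} (hb : 0 < b) {W : Set (ℕ → R)}
    (hW : ∀ r < b, ∀ u ∈ W, decimate b r u ∈ W) {s : ℕ → R} (hs : s ∈ W) : kernel b s ⊆ W := by
  rintro _ ⟨i, j, hj, rfl⟩
  induction i generalizing s j with
  | zero =>
    obtain rfl : j = 0 := by simpa using hj
    simpa using hs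
  | succ i ih =>
    -- The last base-`b` digit of `j` selects the decimation that is applied first.
    have hj' : j / b < b ^ i := Nat.div_lt_of_lt_mul (by rwa [← pow_succ'])
    convert ih (hW (j % b) (Nat.mod_lt _ hb) s hs) (j / b) hj' using 1
    ext n
    rw [decimate_apply, mul_add, add_assoc, Nat.div_add_mod, ← mul_assoc, ← pow_succ']

theorem LiesInStableModule.isAutomatic [Finite R] {b : ℕ} (hb : 2 ≤ b) {s : ℕ → R}
    (hs : LiesInStableModule b s) : IsAutomatic b s := by
  obtain ⟨W, hfg, hsW, hW⟩ := hs
  have : Module.Finite R W := Module.Finite.iff_fg.mpr hfg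
  have : Finite W := Module.finite_of_finite R
  exact ⟨hb, (Set.toFinite (W : Set (ℕ → R))).subset
    (kernel_subset_of_stable (by omega) hW hsW)⟩

end AutomaticSequence

namespace MaryPartition

theorem expand_factor {m : ℕ} (hm : m ≠ 0) (j : ℕ) :
    PowerSeries.expand m hm (factor m j) = factor m (j + 1) := by
  have hm' : 1 ≤ m := Nat.one_le_iff_ne_zero.mpr hm
  have h := congrArg (PowerSeries.expand m hm) (mul_factor hm' j)
  rw [map_mul, map_sub, map_mul, map_pow, map_one, PowerSeries.expand_C, PowerSeries.expand_X,
    ← pow_mul, ← pow_succ'] at h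
  exact left_inv_eq_right_inv (by rwa [mul_comm]) (mul_factor hm' (j + 1))

open scoped PowerSeries.WithPiTopology in
theorem continuous_expand {S : Type*} [CommRing S] [TopologicalSpace S] {m : ℕ} (hm : m ≠ 0) :
    Continuous (PowerSeries.expand (R := S) m hm) := by
  refine continuous_pi fun d => ?_
  obtain ⟨n, rfl⟩ : ∃ n, d = Finsupp.single () n := ⟨d (), Finsupp.unique_single d⟩
  change Continuous fun f => PowerSeries.coeff n (PowerSeries.expand m hm f)
  simp_rw [PowerSeries.coeff_expand]
  split_ifs
  · exact PowerSeries.WithPiTopology.continuous_coeff S _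
  · exact continuous_const

open scoped PowerSeries.WithPiTopology in
/-- The functional equation `(1 - t q) F(q, t) = F(q ^ m, t)`. -/
theorem one_sub_mul_genFun {m : ℕ} (hm : 2 ≤ m) :
    (1 - PowerSeries.C (Polynomial.X : ℤ[X]) * PowerSeries.X) * genFun m =
      PowerSeries.expand m (by omega) (genFun m) := by
  let _ : TopologicalSpace ℤ[X] := ⊥
  have : DiscreteTopology ℤ[X] := ⟨rfl⟩
  have hm₀ : m ≠ 0 := by omega
  have h : HasProd (fun j => factor m (j + 1)) (PowerSeries.expand m hm₀ (genFun m)) := by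
    have h := (hasProd_genFun hm).map (PowerSeries.expand m hm₀) (continuous_expand hm₀)
    simpa only [Function.comp_def, expand_factor] using h
  have h₁ : genFun m = factor m 0 * PowerSeries.expand m hm₀ (genFun m) :=
    (hasProd_genFun hm).unique h.zero_mul
  have h₂ := mul_factor (m := m) (by omega) 0
  rw [pow_zero, pow_one] at h₂
  conv_lhs => rw [h₁, ← mul_assoc, h₂, one_mul]

theorem poly_succ {m : ℕ} (hm : 2 ≤ m) (n : ℕ) :
    poly m (n + 1) = Polynomial.X * poly m n + if m ∣ n + 1 then poly m ((n + 1) / m) else 0 := by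
  have h := congrArg (PowerSeries.coeff (n + 1)) (one_sub_mul_genFun hm)
  rw [PowerSeries.coeff_expand, sub_mul, one_mul, map_sub, mul_assoc, PowerSeries.coeff_C_mul,
    PowerSeries.coeff_succ_X_mul] at h
  exact eq_add_of_sub_eq' h

theorem a_zero_succ {m : ℕ} (hm : 2 ≤ m) (n : ℕ) :
    a m 0 (n + 1) = if m ∣ n + 1 then a m 0 ((n + 1) / m) else 0 := by
  rw [a, poly_succ hm]
  split_ifs <;> simp [a]

theorem a_succ_succ {m : ℕ} (hm : 2 ≤ m) (k n : ℕ) :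
    a m (k + 1) (n + 1) =
      a m k n + if m ∣ n + 1 then a m (k + 1) ((n + 1) / m) else 0 := by
  rw [a, poly_succ hm]
  split_ifs <;> simp [a]

open AutomaticSequence in
theorem liesInStableModule_a {R : Type*} [CommRing R] {m : ℕ} (hm : 2 ≤ m) (k : ℕ) :
    LiesInStableModule m (fun n => (a m k n : R)) := by
  induction k with
  | zero =>
    refine (LiesInStableModule.zero m).of_succ hm rfl fun n => ?_
    rw [a_zero_succ hm]
    split_ifs <;> simp
  | succ k ih =>
    refine (ih.delay (by omega)).of_succ hm (delay_zero _) fun n => ?_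
    rw [a_succ_succ hm, delay_succ]
    split_ifs <;> simp

end MaryPartition

theorem mainTheorem10 (p : ℕ) (hp : p.Prime) (k : ℕ) :
    AutomaticSequence.IsAutomatic p (fun n : ℕ => (MaryPartition.a p k n : ZMod p)) := by
  have : NeZero p := ⟨hp.ne_zero⟩
  exact (MaryPartition.liesInStableModule_a hp.two_le k).isAutomatic hp.two_le
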